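/- **Setting.** Let $X$ be (the vertex set of) a connected, locally finite graph on which a group $\Gamma$ acts by graph automorphisms, and let $F\subset X$ be a finite set of vertices meeting every $\Gamma$-orbit (for instance a fundamental domain). Let $(I_L)_{L\in\mathbb N}$ be an increasing tempered Følner sequence in $\Gamma$, i.e. finite non-empty sets $I_L\subset I_{L+1}\subset\Gamma$ such that for every finite non-empty $K\subset\Gamma$ and every $\varepsilon>0$ one has $|I_L\,\Delta\,KI_L|\le\varepsilon|I_L|$ for all large $L$, and such that $|I_{L+1}I_L^{-1}|\le C|I_{L+1}|$ for some $C$ and all $L$. Put $\Lambda_L=\bigcup_{\gamma\in I_L^{-1}}\gamma F$. Let $H_0$ be a finite hopping range operator: a bounded linear operator on $\ell^2(X)$ whose matrix elements $H_0(k,j)=\langle\delta_k,H_0\delta_j\rangle$ satisfy $H_0(k,j)=H_0(j,k)\in\mathbb R$, $H_0(\gamma k,\gamma j)=H_0(k,j)$ for all $\gamma\in\Gamma$, and, for some $R\in\mathbb N$, $H_0(k,j)=0$ whenever $\operatorname{dist}(k,j)\ge R$. Let $\mathbb P$ be a probability measure on $\Omega=[0,\infty]^X$ (with the product $\sigma$-algebra),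 let $q_k(\omega)=\omega_k$, and assume that the shifts $(\tau_\gamma\omega)_k=\omega_{\gamma^{-1}k}$, $\gamma\in\Gamma$, preserve $\mathbb P$ and act ergodically. Let $X(\omega)=\{k: q_k(\omega)<\infty\}$, and let $H_\omega$ be the random Hamiltonian $$(H_\omega f)(k)=q_k(\omega)f(k)+\sum_{j\in X(\omega)}H_0(k,j)f(j)$$ on $\ell^2(X(\omega))$. For finite $\Lambda\subset X$ let $H_\omega^\Lambda$ be its restriction to $\ell^2(\Lambda\cap X(\omega))$, i.e. the matrix $(H_\omega(k,j))_{k,j\in\Lambda\cap X(\omega)}$, and let $$N(H_\omega^\Lambda,E)=\frac{\#\{\text{eigenvalues of } H_\omega^\Lambda \text{ that are } <E,\text{ counted with multiplicity}\}}{\#\Lambda}.$$ An *integrated density of states* (IDS) of $(H_\omega)_\omega$ along $(\Lambda_L)$ is a non-decreasing, left-continuous function $N:\mathbb R\to\mathbb R$ such that, for $\mathbb P$-almost every $\omega$, $\lim_{L\to\infty}N(H_\omega^{\Lambda_L},E)=N(E)$ at every continuity point $E$ of $N$. **Theorem.** Assume that the random variables $q_k$, $k\in X$, are independent and that their distributions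 have no atoms at finite values, i.e. $\mathbb P\{q_k=a\}=0$ for all $k\in X$ and all $a\in[0,\infty)$ (for a common distribution $\mu$ this says $\mu=\mu_c+(1-p)\delta_\infty$ with $\mu_c$ an atomless measure on $[0,\infty)$ of mass $p$). Then the IDS $N$ of $(H_\omega)_\omega$ is continuous on $\mathbb R$. -/

import Mathlib

open MeasureTheory ProbabilityTheory Filter Topology
open scoped ENNReal Pointwise

noncomputable section

/-- The Hilbert space `ℓ²(X)` of complex valued square summable functions on `X`. -/
abbrev EllTwo (X : Type*) : Type _ := lp (fun _ : X => ℂ) 2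

open Classical in
/-- The function `δ_k ∈ ℓ²(X)`: value `1` at `k`, value `0` elsewhere. -/
def delta {X : Type*} (k : X) : EllTwo X := lp.single 2 k (1 : ℂ)

/-- The matrix element `H₀(k,j) = ⟨δ_k, H₀ δ_j⟩`. -/
def kernel {X : Type*} (H₀ : EllTwo X →L[ℂ] EllTwo X) (k j : X) : ℂ :=
  inner ℂ (delta k) (H₀ (delta j))

/-- The action of `Γ` on the vertices of the graph `G` is by graph automorphisms. -/
def ActsByAutomorphisms (Γ : Type*) {X : Type*} [Group Γ] [MulAction Γ X]
    (G : SimpleGraph X) : Prop :=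
  ∀ (γ : Γ) (k j : X), G.Adj (γ • k) (γ • j) ↔ G.Adj k j

/-- A finite hopping range operator on `ℓ²(X)`: a bounded operator with real symmetric,
`Γ`-invariant matrix elements that vanish at graph distance `≥ R` for some `R`. -/
structure FiniteHoppingOperator (Γ : Type*) {X : Type*} [Group Γ] [MulAction Γ X]
    (G : SimpleGraph X) where
  /-- the operator itself -/
  op : EllTwo X →L[ℂ] EllTwo X
  real : ∀ k j, (kernel op k j).im = 0
  symm : ∀ k j, kernel op k j = kernel op j k
  invariant : ∀ (γ : Γ) (k j : X), kernel op (γ • k) (γ • j) = kernel op k j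
  finite_range : ∃ R : ℕ, ∀ k j, R ≤ G.dist k j → kernel op k j = 0

/-- A configuration assigns to every vertex `k` a potential value `q_k(ω) = ω k ∈ [0,∞]`. The
configuration space carries the product `σ`-algebra. -/
abbrev Config (X : Type*) : Type _ := X → ℝ≥0∞

/-- The shift `(τ_γ ω)_k = ω_{γ⁻¹ k}`. -/
def shift {Γ X : Type*} [Group Γ] [MulAction Γ X] (γ : Γ) (ω : Config X) : Config X :=
  fun k => ω (γ⁻¹ • k)

/-- The shifts `τ_γ` preserve `P`. -/
def IsStationaryField (Γ : Type*) {X : Type*} [Group Γ] [MulAction Γ X]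
    (P : Measure (Config X)) : Prop :=
  ∀ γ : Γ, MeasurePreserving (shift γ) P P

/-- Every event that is invariant under all the shifts `τ_γ` has probability `0` or `1`. -/
def IsErgodicFamily (Γ : Type*) {X : Type*} [Group Γ] [MulAction Γ X]
    (P : Measure (Config X)) : Prop :=
  ∀ A : Set (Config X), MeasurableSet A → (∀ γ : Γ, shift γ ⁻¹' A = A) → P A = 0 ∨ P A = 1

/-- The set `X(ω)` of active vertices. -/
def activeSites {X : Type*} (ω : Config X) : Set X := {k | ω k ≠ ∞}

open Classical in
/-- The matrix elements of the random Hamiltonian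
`(H_ω f)(k) = q_k(ω) f(k) + ∑_{j ∈ X(ω)} H₀(k,j) f(j)` on `ℓ²(X(ω))`. -/
def hamiltonian {Γ X : Type*} [Group Γ] [MulAction Γ X] {G : SimpleGraph X}
    (H₀ : FiniteHoppingOperator Γ G) (ω : Config X) (k j : activeSites ω) : ℂ :=
  (if k = j then ((ω k).toReal : ℂ) else 0) + kernel H₀.op k j

/-- The active vertices in `Λ`; a function in the domain of `H_ω` that is supported in `Λ` lives
on these vertices. -/
abbrev ActiveIn {X : Type*} (Λ : Finset X) (ω : Config X) : Type _ :=
  {k : activeSites ω // (k : X) ∈ Λ}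

instance {X : Type*} (Λ : Finset X) (ω : Config X) : Finite (ActiveIn Λ ω) :=
  Finite.of_injective (fun k : ActiveIn Λ ω => (⟨k.1.1, k.2⟩ : {x // x ∈ Λ}))
    (fun _ _ h => Subtype.ext (Subtype.ext (Subtype.mk.inj h)))

instance {X : Type*} (Λ : Finset X) (ω : Config X) : Fintype (ActiveIn Λ ω) :=
  Fintype.ofFinite _

/-- The restriction `H_ω^Λ` of the random Hamiltonian to the finite set `Λ`, as a matrix. -/
def restricted {Γ X : Type*} [Group Γ] [MulAction Γ X] {G : SimpleGraph X}
    (H₀ : FiniteHoppingOperator Γ G) (ω : Config X) (Λ : Finset X) :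
    Matrix (ActiveIn Λ ω) (ActiveIn Λ ω) ℂ :=
  Matrix.of fun k j => hamiltonian H₀ ω k.1 j.1

theorem restricted_isHermitian {Γ X : Type*} [Group Γ] [MulAction Γ X] {G : SimpleGraph X}
    (H₀ : FiniteHoppingOperator Γ G) (ω : Config X) (Λ : Finset X) :
    (restricted H₀ ω Λ).IsHermitian := by
  ext k j
  have h : (starRingEnd ℂ) (kernel H₀.op (j.1 : X) (k.1 : X)) = kernel H₀.op k.1 j.1 := by
    rw [H₀.symm k.1 j.1]
    exact Complex.conj_eq_iff_im.2 (H₀.real _ _)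
  by_cases hkj : k.1 = j.1
  · simp [restricted, hamiltonian, hkj] at h ⊢
    exact h
  · have hjk : ¬ j.1 = k.1 := fun e => hkj e.symm
    simp [restricted, hamiltonian, hkj, hjk] at h ⊢
    exact h

open Classical in
/-- The normalised eigenvalue counting function
`N(H_ω^Λ, E) = #{i | E_i(H_ω^Λ) < E} / #Λ`, eigenvalues being counted with multiplicity. The
normalisation is by the number of all vertices of `Λ`, active or not. -/
def countingFunction {Γ X : Type*} [Group Γ] [MulAction Γ X] {G : SimpleGraph X}
    (H₀ : FiniteHoppingOperator Γ G) (ω : Config X) (Λ : Finset X) (E : ℝ) : ℝ :=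
  (Nat.card {i : ActiveIn Λ ω // (restricted_isHermitian H₀ ω Λ).eigenvalues i < E} : ℝ) / Λ.card

open Classical in
/-- An increasing, tempered Følner sequence of finite non-empty subsets of `Γ`. -/
structure IsTemperedFolner {Γ : Type*} [Group Γ] (I : ℕ → Finset Γ) : Prop where
  nonempty : ∀ L, (I L).Nonempty
  increasing : Monotone I
  folner : ∀ K : Finset Γ, K.Nonempty → ∀ ε : ℝ, 0 < ε →
    ∀ᶠ L in atTop, ((symmDiff (I L) (K * I L)).card : ℝ) ≤ ε * (I L).card
  tempered : ∃ C : ℝ, ∀ L, ((I (L + 1) * (I L)⁻¹).card : ℝ) ≤ C * (I (L + 1)).card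

open Classical in
/-- The exhaustion `Λ_L = ⋃_{γ ∈ I_L⁻¹} γ F`. -/
def exhaustion {Γ X : Type*} [Group Γ] [MulAction Γ X] (I : ℕ → Finset Γ) (F : Finset X)
    (L : ℕ) : Finset X :=
  (I L)⁻¹ • F

/-- `N` is the integrated density of states of `(H_ω)_ω`: a (left continuous) distribution
function such that, for `P`-almost every `ω`, the finite volume counting functions
`N_ω^L(E) = N(H_ω^{Λ_L}, E)` converge to `N(E)` at all continuity points `E` of `N`. -/
structure IsIDS {Γ X : Type*} [Group Γ] [MulAction Γ X] {G : SimpleGraph X}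
    (H₀ : FiniteHoppingOperator Γ G) (P : Measure (Config X)) (Λ : ℕ → Finset X)
    (N : ℝ → ℝ) : Prop where
  mono : Monotone N
  left_continuous : ∀ E, ContinuousWithinAt N (Set.Iic E) E
  tendsto : ∀ᵐ ω ∂P, ∀ E, ContinuousAt N E →
    Tendsto (fun L => countingFunction H₀ ω (Λ L) E) atTop (𝓝 (N E))

end

/-! `N` is monotone, so only jumps have to be excluded, and a Wegner estimate uniform in the volume
does this: the expected number of eigenvalues of `H_ω^Λ` in `[E, E + c)` is at most `η * #Λ`, where
`η` bounds the probability that some fixed `q_k` falls in an interval `[a, a + c]` with `a` finite.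

Raising the potential by `c` on all of `Λ` shifts the spectrum by `c`, so the eigenvalues in the
window are exactly those lost below `E + c` by this raise. Raise one site at a time. Each raise is a
nonnegative perturbation of rank at most one and loses at most one eigenvalue
(`Matrix.IsHermitian.card_eigenvalues_lt_le`). With the other sites fixed, a loss confines the value
at that site to an interval of length `c` (`setOf_eigenvalueCount_update_lt_subset`), which by
independence has probability at most `η`. Summing over the sites gives
`integral_countingFunction_le_add`.

Absence of finite atoms, together with stationarity and the finiteness of `F`, makes `η` as small as
desired for suitable `c`. Dominated convergence carries the estimate to `N` at its continuity
points, which are dense. -/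

/-! ### Eigenvalue counts under diagonal perturbations -/

namespace Matrix.IsHermitian

variable {ι κ : Type*} [Fintype ι] [DecidableEq ι] [Fintype κ] [DecidableEq κ]

/-- The quadratic form of a Hermitian matrix in its eigenbasis. -/
theorem re_inner_toEuclideanLin {A : Matrix ι ι ℂ} (hA : A.IsHermitian)
    (v : EuclideanSpace ℂ ι) :
    (inner ℂ v (Matrix.toEuclideanLin A v)).re =
      ∑ i, hA.eigenvalues i * ‖inner ℂ (hA.eigenvectorBasis i) v‖ ^ 2 := by
  have hs : (Matrix.toEuclideanLin A).IsSymmetric := Matrix.isSymmetric_toEuclideanLin_iff.2 hA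
  have hb (i : ι) : Matrix.toEuclideanLin A (hA.eigenvectorBasis i) =
      (hA.eigenvalues i : ℂ) • hA.eigenvectorBasis i := by
    apply (WithLp.ofLp_injective 2)
    have := hA.mulVec_eigenvectorBasis i
    simpa [Matrix.toEuclideanLin, Matrix.toLpLin_apply] using this
  rw [← hA.eigenvectorBasis.sum_inner_mul_inner, Complex.re_sum]
  refine Finset.sum_congr rfl fun i _ => ?_
  rw [← hs, hb, inner_smul_left, Complex.conj_ofReal, mul_left_comm, Complex.re_ofReal_mul,
    ← inner_conj_symm, ← Complex.normSq_eq_conj_mul_self, Complex.normSq_eq_norm_sq]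
  rfl

/-- If a Hermitian matrix `B` arises from `A` by adding a real diagonal matrix and relabelling, then
passing from `A` to `B` and from the threshold `a` to `b` can only lose as many eigenvalues below the
threshold as there are diagonal entries exceeding `b - a`. -/
theorem card_eigenvalues_lt_le {A : Matrix ι ι ℂ} {B : Matrix κ κ ℂ} (hA : A.IsHermitian)
    (hB : B.IsHermitian) (e : ι ≃ κ) (d : ι → ℝ)
    (hd : ∀ i j, B (e i) (e j) = A i j + if i = j then (d i : ℂ) else 0) (a b : ℝ) :
    Nat.card {i // hA.eigenvalues i < a} ≤
      Nat.card {i // hB.eigenvalues i < b} + Nat.card {i // b - a < d i} := by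
  classical
  let T : EuclideanSpace ℂ ι →ₗ[ℂ] EuclideanSpace ℂ κ :=
    (WithLp.linearEquiv 2 ℂ (κ → ℂ)).symm.toLinearMap ∘ₗ LinearMap.funLeft ℂ ℂ e.symm ∘ₗ
      (WithLp.linearEquiv 2 ℂ (ι → ℂ)).toLinearMap
  have hT (v : EuclideanSpace ℂ ι) (j : κ) : T v j = v (e.symm j) := rfl
  -- A kernel vector is a combination of eigenvectors of `A` below `a`, is orthogonal after
  -- relabelling to those of `B` below `b`, and vanishes where `d` exceeds `b - a`. These conditions
  -- force it to be zero, and comparing dimensions gives the bound.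
  let Φ : EuclideanSpace ℂ ι →ₗ[ℂ] ({j // hB.eigenvalues j < b} → ℂ) ×
      ({i // ¬ hA.eigenvalues i < a} → ℂ) × ({i // b - a < d i} → ℂ) :=
    (LinearMap.pi fun j : {j // hB.eigenvalues j < b} => (innerₛₗ ℂ (hB.eigenvectorBasis j.1)) ∘ₗ T).prod
      ((LinearMap.pi fun i : {i // ¬ hA.eigenvalues i < a} => innerₛₗ ℂ (hA.eigenvectorBasis i.1)).prod
        (LinearMap.pi fun i : {i // b - a < d i} => (LinearMap.proj i.1) ∘ₗ
          (WithLp.linearEquiv 2 ℂ (ι → ℂ)).toLinearMap))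
  have hΦ : Function.Injective Φ := by
    rw [← LinearMap.ker_eq_bot, LinearMap.ker_eq_bot']
    intro v hv
    have h1 (j) (hj : hB.eigenvalues j < b) : inner ℂ (hB.eigenvectorBasis j) (T v) = 0 :=
      congrFun (congrArg Prod.fst hv) ⟨j, hj⟩
    have h2 (i) (hi : ¬ hA.eigenvalues i < a) : inner ℂ (hA.eigenvectorBasis i) v = 0 :=
      congrFun (congrArg (fun x => x.2.1) hv) ⟨i, hi⟩
    have h3 (i) (hi : b - a < d i) : v i = 0 :=
      congrFun (congrArg (fun x => x.2.2) hv) ⟨i, hi⟩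
    have hnT : ‖T v‖ ^ 2 = ‖v‖ ^ 2 := by
      rw [EuclideanSpace.norm_sq_eq, EuclideanSpace.norm_sq_eq, ← e.sum_comp]
      simp [hT]
    have hform : (inner ℂ (T v) (Matrix.toEuclideanLin B (T v))).re =
        (inner ℂ v (Matrix.toEuclideanLin A v)).re + ∑ i, d i * ‖v i‖ ^ 2 := by
      have key : inner ℂ (T v) (Matrix.toEuclideanLin B (T v)) =
        inner ℂ v (Matrix.toEuclideanLin A v) + ((∑ i, d i * ‖v i‖ ^ 2 : ℝ) : ℂ) := by
        simp only [PiLp.inner_apply, Matrix.toEuclideanLin, Matrix.toLpLin_apply, Matrix.mulVec,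
          dotProduct, RCLike.inner_apply, ← e.sum_comp, hT, e.symm_apply_apply, hd, add_mul,
          Finset.sum_add_distrib, ite_mul, zero_mul, Finset.sum_ite_eq, Finset.mem_univ, if_true]
        push_cast
        congr 1
        refine Finset.sum_congr rfl fun i _ => ?_
        rw [mul_assoc, Complex.mul_conj, Complex.normSq_eq_norm_sq]
        push_cast
        rfl
      rw [key, Complex.add_re, Complex.ofReal_re]
    have hdle : ∑ i, d i * ‖v i‖ ^ 2 ≤ (b - a) * ‖v‖ ^ 2 := by
      rw [EuclideanSpace.norm_sq_eq, Finset.mul_sum]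
      refine Finset.sum_le_sum fun i _ => ?_
      by_cases hi : b - a < d i
      · simp [h3 i hi]
      · exact mul_le_mul_of_nonneg_right (not_lt.1 hi) (sq_nonneg _)
    have hBge : b * ‖v‖ ^ 2 ≤ (inner ℂ (T v) (Matrix.toEuclideanLin B (T v))).re := by
      rw [hB.re_inner_toEuclideanLin, ← hnT, ← hB.eigenvectorBasis.sum_sq_norm_inner_right,
        Finset.mul_sum]
      refine Finset.sum_le_sum fun i _ => ?_
      by_cases hi : hB.eigenvalues i < b
      · simp [h1 i hi]
      · exact mul_le_mul_of_nonneg_right (not_lt.1 hi) (sq_nonneg _)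
    have hAle : a * ‖v‖ ^ 2 ≤ (inner ℂ v (Matrix.toEuclideanLin A v)).re := by linarith
    have hterm (i : ι) : hA.eigenvalues i * ‖inner ℂ (hA.eigenvectorBasis i) v‖ ^ 2 ≤
        a * ‖inner ℂ (hA.eigenvectorBasis i) v‖ ^ 2 := by
      by_cases hi : hA.eigenvalues i < a
      · exact mul_le_mul_of_nonneg_right hi.le (sq_nonneg _)
      · simp [h2 i hi]
    rw [hA.re_inner_toEuclideanLin, ← hA.eigenvectorBasis.sum_sq_norm_inner_right v,
      Finset.mul_sum] at hAle
    -- The form of `A` at `v` is both at most and at least `a * ‖v‖ ^ 2`, so equality holds term by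
    -- term. As the eigenvalues involved are strictly below `a`, every coefficient vanishes.
    have heq := (Finset.sum_eq_sum_iff_of_le fun i _ => hterm i).1
      (le_antisymm (Finset.sum_le_sum fun i _ => hterm i) hAle)
    have hzero (i : ι) : inner ℂ (hA.eigenvectorBasis i) v = 0 := by
      by_cases hi : hA.eigenvalues i < a
      · have := heq i (Finset.mem_univ _)
        rcases mul_eq_mul_right_iff.1 this with h | h
        · exact absurd h hi.ne
        · simpa using h
      · exact h2 i hi
    rw [← norm_eq_zero, ← sq_eq_zero_iff, ← hA.eigenvectorBasis.sum_sq_norm_inner_right v]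
    simp [hzero]
  have hfin := LinearMap.finrank_le_finrank_of_injective hΦ
  rw [finrank_euclideanSpace, Module.finrank_prod, Module.finrank_prod, Module.finrank_pi,
    Module.finrank_pi, Module.finrank_pi, Fintype.card_subtype_compl] at hfin
  have := Fintype.card_subtype_le fun i => hA.eigenvalues i < a
  simp only [Nat.card_eq_fintype_card]
  omega

end Matrix.IsHermitian

/-! ### Short intervals in `[0,∞]` -/

/-- A finite measure on `[0,∞]` without atoms at finite values gives uniformly small mass to short
intervals of finite numbers. -/
theorem exists_forall_measure_Icc_add_le (μ : Measure ℝ≥0∞) [IsFiniteMeasure μ]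
    (hμ : ∀ a, a ≠ ∞ → μ {a} = 0) {η : ℝ≥0∞} (hη : η ≠ 0) :
    ∃ c : ℝ≥0∞, c ≠ 0 ∧ c ≠ ∞ ∧ ∀ a ≠ ∞, μ (Set.Icc a (a + c)) ≤ η := by
  by_contra! h
  have hn (n : ℕ) : ∃ a ≠ ∞, η < μ (Set.Icc a (a + ((n : ℝ≥0∞) + 1)⁻¹)) :=
    h _ (by simp) (by simp)
  choose u hu hlt using hn
  obtain ⟨a, -, φ, hφ, ha⟩ := isCompact_univ.tendsto_subseq (x := u) fun _ => Set.mem_univ _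
  -- Discarding `∞` makes the limit point null even when it is `∞` itself. The intervals have finite
  -- endpoints, so they lose no mass.
  have hν : μ.restrict {∞}ᶜ {a} < η := by
    rw [Measure.restrict_apply (measurableSet_singleton a)]
    refine lt_of_eq_of_lt ?_ (pos_iff_ne_zero.2 hη)
    by_cases hat : a = ∞
    · simp [hat]
    · exact measure_mono_null Set.inter_subset_left (hμ a hat)
  obtain ⟨U, haU, hUo, hU⟩ := Set.exists_isOpen_lt_of_lt _ _ hν
  have h0 : Tendsto (fun n : ℕ => ((n : ℝ≥0∞) + 1)⁻¹) atTop (𝓝 0) := by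
    have := (tendsto_add_atTop_iff_nat 1).2 ENNReal.tendsto_inv_nat_nhds_zero
    simpa using this
  have h1 : Tendsto (fun n => u (φ n) + ((φ n : ℝ≥0∞) + 1)⁻¹) atTop (𝓝 a) := by
    simpa using ha.add (h0.comp hφ.tendsto_atTop)
  have h2 := (ha.Icc h1).eventually
    (eventually_smallSets_subset.2 (hUo.mem_nhds (haU rfl)))
  obtain ⟨n, hn⟩ := h2.exists
  refine (hlt (φ n)).not_ge (le_trans ?_ hU.le)
  refine le_trans (measure_mono ?_) (Measure.le_restrict_apply _ _)
  refine Set.subset_inter hn fun x hx hx' => ?_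
  refine (lt_of_le_of_lt hx.2 ?_).ne hx'
  exact ENNReal.add_lt_top.2 ⟨(hu _).lt_top, by simp⟩

/-- A set of numbers in `[0,∞]` whose elements differ by at most `c` lies in an interval of
length `c`. -/
theorem subset_Icc_sInf_add {s : Set ℝ≥0∞} {c : ℝ≥0∞}
    (h : ∀ x ∈ s, ∀ y ∈ s, y ≤ x + c) : s ⊆ Set.Icc (sInf s) (sInf s + c) := by
  intro y hy
  refine ⟨sInf_le hy, ?_⟩
  rw [ENNReal.sInf_add]
  exact le_iInf₂ fun x hx => h x hx y hy

/-! ### Monotonicity and measurability of the eigenvalue count -/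

section EigenvalueCount

variable {Γ X : Type*} [Group Γ] [MulAction Γ X] {G : SimpleGraph X}

open Classical in
/-- The number of eigenvalues of `H_ω^Λ` below `E`, counted with multiplicity. -/
noncomputable def eigenvalueCount (H₀ : FiniteHoppingOperator Γ G) (ω : Config X) (Λ : Finset X)
    (E : ℝ) : ℕ :=
  Nat.card {i : ActiveIn Λ ω // (restricted_isHermitian H₀ ω Λ).eigenvalues i < E}

theorem countingFunction_eq_div (H₀ : FiniteHoppingOperator Γ G) (ω : Config X) (Λ : Finset X)
    (E : ℝ) : countingFunction H₀ ω Λ E = eigenvalueCount H₀ ω Λ E / Λ.card := rfl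

theorem eigenvalueCount_le_card (H₀ : FiniteHoppingOperator Γ G) (ω : Config X) (Λ : Finset X)
    (E : ℝ) : eigenvalueCount H₀ ω Λ E ≤ Λ.card := by
  classical
  rw [← Nat.card_eq_finsetCard]
  refine Nat.card_le_card_of_injective
    (fun i => (⟨i.1.1.1, i.1.2⟩ : Λ)) fun i j h => ?_
  exact Subtype.ext (Subtype.ext (Subtype.ext (Subtype.mk.inj h)))

/-- Equal sets of active sites make the two matrices differ by a diagonal one, and each exceptional
site in `S` costs at most one eigenvalue. A singleton `S` gives the rank-one bound, an empty one
gives monotonicity. -/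
theorem eigenvalueCount_le_add_card (H₀ : FiniteHoppingOperator Γ G) {ω ω' : Config X}
    {Λ : Finset X} {E E' : ℝ} (S : Finset X) (hact : ∀ k ∈ Λ, ω k = ∞ ↔ ω' k = ∞)
    (hS : ∀ k ∈ Λ, k ∉ S → ω k ≠ ∞ → (ω' k).toReal - (ω k).toReal ≤ E' - E) :
    eigenvalueCount H₀ ω Λ E ≤ eigenvalueCount H₀ ω' Λ E' + S.card := by
  classical
  let e : ActiveIn Λ ω ≃ ActiveIn Λ ω' :=
    { toFun := fun k => ⟨⟨k.1.1, fun h => k.1.2 ((hact _ k.2).2 h)⟩, k.2⟩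
      invFun := fun k => ⟨⟨k.1.1, fun h => k.1.2 ((hact _ k.2).1 h)⟩, k.2⟩
      left_inv := fun _ => rfl
      right_inv := fun _ => rfl }
  refine (Matrix.IsHermitian.card_eigenvalues_lt_le (restricted_isHermitian H₀ ω Λ)
    (restricted_isHermitian H₀ ω' Λ) e
    (fun k => (ω' k.1.1).toReal - (ω k.1.1).toReal) ?_ E E').trans ?_
  · intro i j
    by_cases hij : i = j
    · subst hij
      simp only [restricted, hamiltonian, Matrix.of_apply, if_true]
      simp only [e, Equiv.coe_fn_mk]
      push_cast
      ring
    · have h1 : i.1 ≠ j.1 := fun h => hij (Subtype.ext h)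
      have h2 : (e i).1 ≠ (e j).1 := fun h => hij (e.injective (Subtype.ext h))
      simp only [restricted, hamiltonian, Matrix.of_apply, if_neg h1, if_neg h2, if_neg hij]
      simp only [e, Equiv.coe_fn_mk]
      ring
  · refine Nat.add_le_add_left ?_ _
    rw [← Nat.card_eq_finsetCard]
    refine Nat.card_le_card_of_injective (fun i => (⟨i.1.1.1, ?_⟩ : S)) fun i j h => ?_
    · by_contra hi
      exact (hS _ i.1.2 hi i.1.1.2).not_gt i.2
    · exact Subtype.ext (Subtype.ext (Subtype.ext (Subtype.mk.inj h)))

theorem eigenvalueCount_le (H₀ : FiniteHoppingOperator Γ G) {ω ω' : Config X}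
    {Λ : Finset X} {E E' : ℝ} (hact : ∀ k ∈ Λ, ω k = ∞ ↔ ω' k = ∞)
    (h : ∀ k ∈ Λ, ω k ≠ ∞ → (ω' k).toReal - (ω k).toReal ≤ E' - E) :
    eigenvalueCount H₀ ω Λ E ≤ eigenvalueCount H₀ ω' Λ E' :=
  eigenvalueCount_le_add_card H₀ ∅ hact fun k hk _ => h k hk

theorem eigenvalueCount_congr (H₀ : FiniteHoppingOperator Γ G) {ω ω' : Config X}
    {Λ : Finset X} (E : ℝ) (h : ∀ k ∈ Λ, ω k = ω' k) :
    eigenvalueCount H₀ ω Λ E = eigenvalueCount H₀ ω' Λ E :=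
  le_antisymm (eigenvalueCount_le H₀ (fun k hk => by rw [h k hk]) fun k hk _ => by simp [h k hk])
    (eigenvalueCount_le H₀ (fun k hk => by rw [h k hk]) fun k hk _ => by simp [h k hk])

theorem eigenvalueCount_antitone (H₀ : FiniteHoppingOperator Γ G) {ω ω' : Config X}
    {Λ : Finset X} (E : ℝ) (hact : ∀ k ∈ Λ, ω k = ∞ ↔ ω' k = ∞) (h : ∀ k ∈ Λ, ω' k ≤ ω k) :
    eigenvalueCount H₀ ω Λ E ≤ eigenvalueCount H₀ ω' Λ E :=
  eigenvalueCount_le H₀ hact fun k hk hk' => by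
    have := ENNReal.toReal_mono hk' (h k hk)
    linarith

/-- The counting function is left continuous in the energy. -/
theorem exists_eigenvalueCount_sub_eq (H₀ : FiniteHoppingOperator Γ G) (ω : Config X)
    (Λ : Finset X) (E : ℝ) :
    ∃ δ > 0, eigenvalueCount H₀ ω Λ (E - δ) = eigenvalueCount H₀ ω Λ E := by
  classical
  have h (i : ActiveIn Λ ω) : ∀ᶠ x in 𝓝[<] E,
      ((restricted_isHermitian H₀ ω Λ).eigenvalues i < x ↔
        (restricted_isHermitian H₀ ω Λ).eigenvalues i < E) := by
    by_cases hi : (restricted_isHermitian H₀ ω Λ).eigenvalues i < E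
    · filter_upwards [mem_nhdsWithin_of_mem_nhds (lt_mem_nhds hi)] with x hx
      exact ⟨fun _ => hi, fun _ => hx⟩
    · filter_upwards [self_mem_nhdsWithin] with x hx
      exact ⟨fun h => h.trans hx, fun h => absurd h hi⟩
  obtain ⟨x, hx, hxE⟩ := ((eventually_all.2 h).and self_mem_nhdsWithin).exists
  refine ⟨E - x, sub_pos.2 hxE, ?_⟩
  rw [sub_sub_cancel]
  exact Nat.card_congr (Equiv.subtypeEquivRight hx)

/-- The count is antitone in the potential and, being left continuous in the energy, survives a
small enough raise. Hence a superlevel set is a countable union of sets of configurations dominated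
on `Λ` by a rational one with the same infinite sites. -/
theorem measurable_eigenvalueCount (H₀ : FiniteHoppingOperator Γ G) (Λ : Finset X) (E : ℝ) :
    Measurable fun ω : Config X => eigenvalueCount H₀ ω Λ E := by
  classical
  refine measurable_of_Ici fun m => ?_
  -- `none` encodes the value `∞`. The value `0` outside `Λ` plays no role.
  let ext : (Λ → Option NNRat) → Config X := fun r k =>
    if hk : k ∈ Λ then (r ⟨k, hk⟩).elim ∞ fun q => ((q : NNReal) : ℝ≥0∞) else 0
  have hset : (fun ω : Config X => eigenvalueCount H₀ ω Λ E) ⁻¹' Set.Ici m =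
      ⋃ r ∈ {r : Λ → Option NNRat | m ≤ eigenvalueCount H₀ (ext r) Λ E},
        ⋂ k ∈ Λ, {ω : Config X | (ω k = ∞ ↔ ext r k = ∞) ∧ ω k ≤ ext r k} := by
    ext ω
    simp only [Set.mem_preimage, Set.mem_Ici, Set.mem_iUnion, Set.mem_iInter, Set.mem_ofPred_eq,
      exists_prop]
    constructor
    · intro hm
      obtain ⟨δ, hδ, hδE⟩ := exists_eigenvalueCount_sub_eq H₀ ω Λ E
      have hq (k : Λ) : ∃ q : Option NNRat,
          let x : ℝ≥0∞ := q.elim ∞ fun q => ((q : NNReal) : ℝ≥0∞)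
          (ω k = ∞ ↔ x = ∞) ∧ ω k ≤ x ∧ (ω k ≠ ∞ → x.toReal - (ω k).toReal ≤ δ) := by
        by_cases hk : ω k = ∞
        · exact ⟨none, by simp [hk]⟩
        · obtain ⟨q, hq1, hq2⟩ := exists_rat_btwn
            (lt_add_of_pos_right (ω k).toReal hδ)
          have hq0 : 0 ≤ q := by
            have : (0 : ℝ) ≤ q := ENNReal.toReal_nonneg.trans hq1.le
            exact_mod_cast this
          lift q to NNRat using hq0
          have hqr : (((q : NNReal) : ℝ≥0∞)).toReal = ((q : ℚ) : ℝ) := rfl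
          refine ⟨some q, by simp [hk], ?_, fun _ => ?_⟩
          · rw [← ENNReal.toReal_le_toReal hk (by simp), Option.elim_some, hqr]
            exact hq1.le
          · rw [Option.elim_some, hqr]
            linarith
      choose r hr1 hr2 hr3 using hq
      have hext (k : X) (hk : k ∈ Λ) :
          ext r k = (r ⟨k, hk⟩).elim ∞ fun q => ((q : NNReal) : ℝ≥0∞) := dif_pos hk
      refine ⟨r, hm.trans ?_, fun k hk => ?_⟩
      · rw [← hδE]
        refine eigenvalueCount_le H₀ (fun k hk => ?_) fun k hk hk' => ?_
        · rw [hext k hk]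
          exact hr1 ⟨k, hk⟩
        · rw [hext k hk, sub_sub_cancel]
          exact hr3 ⟨k, hk⟩ hk'
      · rw [hext k hk]
        exact ⟨hr1 ⟨k, hk⟩, hr2 ⟨k, hk⟩⟩
    · rintro ⟨r, hr, h⟩
      exact hr.trans (eigenvalueCount_antitone H₀ E (fun k hk => (h k hk).1.symm)
        fun k hk => (h k hk).2)
  rw [hset]
  refine MeasurableSet.biUnion (Set.to_countable _) fun r _ => ?_
  refine Finset.measurableSet_biInter _ fun k _ => ?_
  have hm : MeasurableSet {ω : Config X | ω k = ∞} :=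
    measurableSet_eq_fun (measurable_pi_apply k) measurable_const
  have hk : MeasurableSet {ω : Config X | ω k = ∞ ↔ ext r k = ∞} := by
    by_cases hk : ext r k = ∞
    · simpa only [hk, iff_true] using hm
    · simp only [hk, iff_false]
      exact hm.compl
  exact hk.inter (measurableSet_le (measurable_pi_apply k) measurable_const)

end EigenvalueCount

/-! ### Conditioning on all sites but one -/

/-- If the coordinates are independent and an event depends on finitely many of them, then a bound on
the conditional probabilities given all coordinates but one bounds the probability of the event. -/
theorem ProbabilityTheory.iIndepFun.measure_le_of_forall_update {X : Type*} [DecidableEq X]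
    {P : Measure (Config X)} [IsProbabilityMeasure P]
    (hindep : iIndepFun (fun (k : X) (ω : Config X) => ω k) P) {Λ : Finset X} {k : X}
    {B : Set (Config X)} (hB : MeasurableSet B)
    (hdep : ∀ ω ω' : Config X, (∀ j ∈ Λ, ω j = ω' j) → ω ∈ B → ω' ∈ B) {η : ℝ≥0∞}
    (h : ∀ ω : Config X, P.map (fun ω => ω k) {z | Function.update ω k z ∈ B} ≤ η) :
    P B ≤ η := by
  -- Only the sites of `Λ` matter for `B`, so the others may be set to `0`. The law of `ω k` with
  -- the remaining sites of `Λ` is then a product, and Fubini applies.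
  let glue : ℝ≥0∞ × (Λ.erase k → ℝ≥0∞) → Config X := fun p =>
    Function.update (fun j => if hj : j ∈ Λ.erase k then p.2 ⟨j, hj⟩ else 0) k p.1
  have hglue : Measurable glue := by
    refine measurable_pi_iff.2 fun j => ?_
    by_cases hjk : j = k
    · subst hjk
      simpa [glue] using measurable_fst
    · by_cases hj : j ∈ Λ.erase k
      · simp only [glue, Function.update_of_ne hjk, dif_pos hj]
        exact (measurable_pi_apply _).comp measurable_snd
      · simp only [glue, Function.update_of_ne hjk, dif_neg hj]
        exact measurable_const
  let Y : Config X → (Λ.erase k → ℝ≥0∞) := fun ω j => ω j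
  have hY : Measurable Y := measurable_pi_iff.2 fun j => measurable_pi_apply _
  have hYk : IndepFun (fun ω : Config X => ω k) Y P :=
    (hindep.indepFun_finset {k} (Λ.erase k) (by simp) fun i => measurable_pi_apply i).comp
      (measurable_pi_apply (⟨k, by simp⟩ : ({k} : Finset X))) measurable_id
  have hk : Measurable fun ω : Config X => ω k := measurable_pi_apply k
  have := Measure.isProbabilityMeasure_map (μ := P) hY.aemeasurable
  have hlaw := (indepFun_iff_map_prod_eq_prod_map_map hk.aemeasurable hY.aemeasurable).1 hYk
  have hpre : (fun ω : Config X => (ω k, Y ω)) ⁻¹' (glue ⁻¹' B) = B := by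
    have hg (ω : Config X) (j : X) (hj : j ∈ Λ) : glue (ω k, Y ω) j = ω j := by
      by_cases hjk : j = k
      · subst hjk
        simp [glue]
      · simp only [glue, Function.update_of_ne hjk, dif_pos (Finset.mem_erase.2 ⟨hjk, hj⟩), Y]
    ext ω
    exact ⟨hdep _ _ (hg ω), hdep _ _ fun j hj => (hg ω j hj).symm⟩
  rw [← hpre, ← Measure.map_apply (hk.prodMk hY) (hglue hB), hlaw,
    Measure.prod_apply_symm (hglue hB)]
  have hint : ∫⁻ _, η ∂(P.map Y) = η := by simp
  rw [← hint]
  refine lintegral_mono fun y => ?_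
  exact h fun j => if hj : j ∈ Λ.erase k then y ⟨j, hj⟩ else 0

/-! ### The Wegner estimate -/

section Wegner

variable {Γ X : Type*} [Group Γ] [MulAction Γ X] {G : SimpleGraph X}

open Classical in
/-- The configuration in which the potential is raised by `c` on `S`. -/
noncomputable def raise (c : ℝ≥0∞) (S : Finset X) (ω : Config X) : Config X :=
  fun k => if k ∈ S then ω k + c else ω k

theorem measurable_raise (c : ℝ≥0∞) (S : Finset X) : Measurable (raise c S) := by
  classical
  refine measurable_pi_iff.2 fun k => ?_
  by_cases hk : k ∈ S
  · simp only [raise, if_pos hk]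
    exact (show Measurable fun ω : Config X => ω k from measurable_pi_apply k).add_const c
  · simp only [raise, if_neg hk]
    exact measurable_pi_apply k

theorem raise_empty (c : ℝ≥0∞) (ω : Config X) : raise c ∅ ω = ω := by
  ext k
  simp [raise]

theorem raise_update_of_notMem [DecidableEq X] (c : ℝ≥0∞) {S : Finset X} {k : X} (hk : k ∉ S)
    (ω : Config X) (z : ℝ≥0∞) :
    raise c S (Function.update ω k z) = Function.update (raise c S ω) k z := by
  ext j
  by_cases hj : j = k
  · subst hj
    simp [raise, hk]
  · simp [raise, hj]

theorem raise_insert_update [DecidableEq X] (c : ℝ≥0∞) {S : Finset X} {k : X}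
    (ω : Config X) (z : ℝ≥0∞) :
    raise c (insert k S) (Function.update ω k z) =
      Function.update (raise c S ω) k (z + c) := by
  ext j
  by_cases hj : j = k
  · subst hj
    simp [raise]
  · simp [raise, hj]

/-- The values of the potential at `k` for which raising it by `c` changes the number of eigenvalues
below `E` lie in an interval of length `c`. -/
theorem setOf_eigenvalueCount_update_lt_subset [DecidableEq X] (H₀ : FiniteHoppingOperator Γ G)
    (Λ : Finset X) (E : ℝ) (ω : Config X) (k : X) {c : ℝ≥0∞} (hc : c ≠ ∞) :
    ∃ a ≠ ∞, {z | eigenvalueCount H₀ (Function.update ω k (z + c)) Λ E <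
      eigenvalueCount H₀ (Function.update ω k z) Λ E} ⊆ Set.Icc a (a + c) := by
  set s := {z | eigenvalueCount H₀ (Function.update ω k (z + c)) Λ E <
      eigenvalueCount H₀ (Function.update ω k z) Λ E} with hs
  have hfin (z) (hz : z ∈ s) : z ≠ ∞ := by
    rintro rfl
    simp [hs] at hz
  have hact {x y : ℝ≥0∞} (hx : x ≠ ∞) (hy : y ≠ ∞) (j : X) :
      Function.update ω k x j = ∞ ↔ Function.update ω k y j = ∞ := by
    by_cases hj : j = k
    · subst hj
      simp [hx, hy]
    · simp [hj]
  have hsub : s ⊆ Set.Icc (sInf s) (sInf s + c) := by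
    refine subset_Icc_sInf_add fun x hx y hy => ?_
    by_contra! hlt
    have hxc : x + c ≠ ∞ := ENNReal.add_ne_top.2 ⟨hfin x hx, hc⟩
    have hyc : y + c ≠ ∞ := ENNReal.add_ne_top.2 ⟨hfin y hy, hc⟩
    have h1 : eigenvalueCount H₀ (Function.update ω k y) Λ E ≤
        eigenvalueCount H₀ (Function.update ω k (x + c)) Λ E :=
      eigenvalueCount_antitone H₀ E (fun j _ => hact (hfin y hy) hxc j)
        fun j _ => Function.update_mono hlt.le j
    have h2 : eigenvalueCount H₀ (Function.update ω k x) Λ E ≤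
        eigenvalueCount H₀ (Function.update ω k (y + c)) Λ E + 1 :=
      eigenvalueCount_le_add_card H₀ {k} (fun j _ => hact (hfin x hx) hyc j) fun j _ hj _ => by
        have hj : j ≠ k := by simpa using hj
        simp [hj]
    -- Writing `n z` for the count with value `z` at `k`, the chain `n y ≤ n (x + c) < n x ≤ n (y +
    -- c) + 1 ≤ n y` is contradictory.
    rw [hs, Set.mem_ofPred_eq] at hx hy
    omega
  rcases s.eq_empty_or_nonempty with h | ⟨z, hz⟩
  · exact ⟨0, by simp, by simp [h]⟩
  · exact ⟨sInf s, ((sInf_le hz).trans_lt (hfin z hz).lt_top).ne, hsub⟩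

theorem integrable_eigenvalueCount_raise (H₀ : FiniteHoppingOperator Γ G)
    (P : Measure (Config X)) [IsProbabilityMeasure P] (Λ S : Finset X) (c : ℝ≥0∞) (E : ℝ) :
    Integrable (fun ω => (eigenvalueCount H₀ (raise c S ω) Λ E : ℝ)) P := by
  refine Integrable.of_bound (C := Λ.card) ?_ (ae_of_all _ fun ω => ?_)
  · exact ((measurable_from_top (f := fun n : ℕ => (n : ℝ))).comp
      ((measurable_eigenvalueCount H₀ Λ E).comp (measurable_raise c S))).aestronglyMeasurable
  · simpa using eigenvalueCount_le_card H₀ (raise c S ω) Λ E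

/-- Since `k ∉ S`, the earlier raises leave the value at `k` alone, so it can be resampled with its
original law while the raised environment stays fixed. -/
theorem measure_eigenvalueCount_raise_insert_lt_le [DecidableEq X]
    (H₀ : FiniteHoppingOperator Γ G) {P : Measure (Config X)} [IsProbabilityMeasure P]
    (hindep : iIndepFun (fun (k : X) (ω : Config X) => ω k) P) (Λ : Finset X) {S : Finset X} {k : X}
    (hk : k ∉ S) {c : ℝ≥0∞} (hc : c ≠ ∞) {η : ℝ≥0∞}
    (hη : ∀ a ≠ ∞, P.map (fun ω => ω k) (Set.Icc a (a + c)) ≤ η) (E : ℝ) :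
    P {ω | eigenvalueCount H₀ (raise c (insert k S) ω) Λ E <
      eigenvalueCount H₀ (raise c S ω) Λ E} ≤ η := by
  refine hindep.measure_le_of_forall_update (Λ := Λ) (k := k) ?_ ?_ ?_
  · exact measurableSet_lt
      ((measurable_eigenvalueCount H₀ Λ E).comp (measurable_raise c (insert k S)))
      ((measurable_eigenvalueCount H₀ Λ E).comp (measurable_raise c S))
  · intro ω ω' h hω
    have hr (T : Finset X) : eigenvalueCount H₀ (raise c T ω) Λ E =
        eigenvalueCount H₀ (raise c T ω') Λ E :=
      eigenvalueCount_congr H₀ E fun j hj => by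
        simp only [raise]
        split_ifs <;> simp [h j hj]
    simpa only [Set.mem_ofPred_eq, hr] using hω
  · intro ω
    simp only [Set.mem_ofPred_eq, raise_update_of_notMem c hk, raise_insert_update]
    obtain ⟨a, ha, hsub⟩ := setOf_eigenvalueCount_update_lt_subset H₀ Λ E (raise c S ω) k hc
    exact (measure_mono hsub).trans (hη a ha)

/-- Each newly raised site loses at most one eigenvalue, and with probability at most `η`, so it
costs at most `η` in expectation. -/
theorem integral_eigenvalueCount_le_raise (H₀ : FiniteHoppingOperator Γ G)
    {P : Measure (Config X)} [IsProbabilityMeasure P]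
    (hindep : iIndepFun (fun (k : X) (ω : Config X) => ω k) P) (Λ : Finset X)
    {c : ℝ≥0∞} (hc : c ≠ ∞) {η : NNReal}
    (hη : ∀ k, ∀ a ≠ ∞, P.map (fun ω => ω k) (Set.Icc a (a + c)) ≤ η) (E : ℝ) (S : Finset X) :
    ∫ ω, (eigenvalueCount H₀ ω Λ E : ℝ) ∂P ≤
      ∫ ω, (eigenvalueCount H₀ (raise c S ω) Λ E : ℝ) ∂P + S.card * η := by
  classical
  induction S using Finset.induction_on with
  | empty => simp [raise_empty]
  | insert k S hk ih =>
    refine ih.trans ?_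
    set B := {ω | eigenvalueCount H₀ (raise c (insert k S) ω) Λ E <
      eigenvalueCount H₀ (raise c S ω) Λ E} with hB
    have hBm : MeasurableSet B := measurableSet_lt
      ((measurable_eigenvalueCount H₀ Λ E).comp (measurable_raise c (insert k S)))
      ((measurable_eigenvalueCount H₀ Λ E).comp (measurable_raise c S))
    have hPB : P.real B ≤ η := ENNReal.toReal_le_coe_of_le_coe
      (measure_eigenvalueCount_raise_insert_lt_le H₀ hindep Λ hk hc (hη k) E)
    have hpt (ω : Config X) : (eigenvalueCount H₀ (raise c S ω) Λ E : ℝ) ≤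
        eigenvalueCount H₀ (raise c (insert k S) ω) Λ E + B.indicator 1 ω := by
      by_cases hω : ω ∈ B
      · have : eigenvalueCount H₀ (raise c S ω) Λ E ≤
            eigenvalueCount H₀ (raise c (insert k S) ω) Λ E + 1 := by
          refine eigenvalueCount_le_add_card H₀ {k} (fun j _ => ?_) fun j _ hj _ => ?_
          · simp only [raise]
            split_ifs <;> simp [hc]
          · have hj : j ≠ k := by simpa using hj
            simp [raise, hj]
        simpa [hω] using (by exact_mod_cast this)
      · have := hω
        rw [hB, Set.mem_ofPred_eq, not_lt] at this
        simpa [hω] using this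
    have hI := integrable_eigenvalueCount_raise H₀ P Λ (insert k S) c E
    have hIB : Integrable (B.indicator (1 : Config X → ℝ)) P :=
      (integrable_const (1 : ℝ)).indicator hBm
    have := integral_mono (integrable_eigenvalueCount_raise H₀ P Λ S c E) (hI.add hIB) hpt
    simp only [Pi.add_apply] at this
    rw [integral_add hI hIB, integral_indicator_one hBm] at this
    rw [Finset.card_insert_of_notMem hk]
    push_cast
    linarith

/-- A Wegner estimate for independent potentials without finite atoms. -/
theorem integral_countingFunction_le_add (H₀ : FiniteHoppingOperator Γ G)
    {P : Measure (Config X)} [IsProbabilityMeasure P]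
    (hindep : iIndepFun (fun (k : X) (ω : Config X) => ω k) P) (Λ : Finset X)
    {c : ℝ≥0∞} (hc : c ≠ ∞) {η : NNReal}
    (hη : ∀ k, ∀ a ≠ ∞, P.map (fun ω => ω k) (Set.Icc a (a + c)) ≤ η) {E E' : ℝ}
    (hE : E' ≤ E + c.toReal) :
    ∫ ω, countingFunction H₀ ω Λ E' ∂P ≤ ∫ ω, countingFunction H₀ ω Λ E ∂P + η := by
  have hle := integral_eigenvalueCount_le_raise H₀ hindep Λ hc hη E' Λ
  -- On `Λ` the raise is uniform, hence an energy shift by `c`, and `E' - c ≤ E`.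
  have hmono : ∫ ω, (eigenvalueCount H₀ (raise c Λ ω) Λ E' : ℝ) ∂P ≤
      ∫ ω, (eigenvalueCount H₀ ω Λ E : ℝ) ∂P := by
    refine integral_mono (integrable_eigenvalueCount_raise H₀ P Λ Λ c E')
      (by simpa [raise_empty] using integrable_eigenvalueCount_raise H₀ P Λ ∅ c E) fun ω => ?_
    refine Nat.cast_le.2 (eigenvalueCount_le H₀ (fun k hk => ?_) fun k hk hk' => ?_)
    · simp [raise, hk, hc]
    · have hk'' : ω k ≠ ∞ := by
        intro h
        simp [raise, hk, h] at hk'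
      simp only [raise, if_pos hk, ENNReal.toReal_add hk'' hc]
      linarith
  simp only [countingFunction_eq_div, integral_div]
  rcases Λ.eq_empty_or_nonempty with rfl | hΛ
  · simp
  · have hpos : (0 : ℝ) < Λ.card := by exact_mod_cast hΛ.card_pos
    rw [div_add' _ _ _ hpos.ne']
    exact div_le_div_of_nonneg_right (by linarith) hpos.le

end Wegner

/-! ### Stationarity, the infinite-volume limit and continuity -/

theorem IsStationaryField.map_eval_smul {Γ X : Type*} [Group Γ] [MulAction Γ X]
    {P : Measure (Config X)} (hstat : IsStationaryField Γ P) (γ : Γ) (k : X) :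
    P.map (fun ω => ω (γ • k)) = P.map (fun ω => ω k) := by
  have hm (j : X) : Measurable fun ω : Config X => ω j := measurable_pi_apply j
  conv_lhs => rw [← (hstat γ).map_eq, Measure.map_map (hm _) (hstat γ).measurable]
  congr 1
  ext ω
  simp [shift]

/-- Under stationarity, bounded intervals of a suitable length have uniformly small
single-site probability. -/
theorem IsStationaryField.exists_forall_map_eval_Icc_le {Γ X : Type*} [Group Γ] [MulAction Γ X]
    {P : Measure (Config X)} [IsProbabilityMeasure P] (hstat : IsStationaryField Γ P)
    (F : Finset X) (hF : ∀ k : X, ∃ γ : Γ, ∃ f ∈ F, k = γ • f)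
    (hatom : ∀ (k : X) (a : ℝ≥0∞), a ≠ ∞ → P {ω | ω k = a} = 0) {η : ℝ≥0∞} (hη : η ≠ 0) :
    ∃ c : ℝ≥0∞, c ≠ 0 ∧ c ≠ ∞ ∧
      ∀ k, ∀ a ≠ ∞, P.map (fun ω => ω k) (Set.Icc a (a + c)) ≤ η := by
  have hm (j : X) : Measurable fun ω : Config X => ω j := measurable_pi_apply j
  have h (k : X) := exists_forall_measure_Icc_add_le (P.map fun ω => ω k)
    (fun a ha => by
      rw [Measure.map_apply (hm k) (measurableSet_singleton a)]
      exact hatom k a ha) hη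
  choose c hc0 hct hc using h
  -- The law at any site is that at some site of `F`, so a minimum over `F` suffices. The `1` keeps
  -- it finite even for empty `F`, where the infimum is `∞`.
  refine ⟨min 1 (F.inf c), ?_, (min_lt_of_left_lt ENNReal.one_lt_top).ne, fun k a ha => ?_⟩
  · refine (lt_min one_pos ?_).ne'
    exact (Finset.lt_inf_iff ENNReal.zero_lt_top).2 fun f _ => pos_iff_ne_zero.2 (hc0 f)
  · obtain ⟨γ, f, hf, rfl⟩ := hF k
    rw [hstat.map_eval_smul]
    refine (measure_mono (Set.Icc_subset_Icc_right ?_)).trans (hc f a ha)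
    gcongr
    exact (min_le_right _ _).trans (Finset.inf_le hf)

/-- The Wegner estimate controls only expectations. Counting functions are bounded by `1`, so the
almost sure limit passes to them. -/
theorem IsIDS.tendsto_integral {Γ X : Type*} [Group Γ] [MulAction Γ X] {G : SimpleGraph X}
    {H₀ : FiniteHoppingOperator Γ G} {P : Measure (Config X)} [IsProbabilityMeasure P]
    {Λ : ℕ → Finset X} {N : ℝ → ℝ} (hN : IsIDS H₀ P Λ N) {E : ℝ} (hE : ContinuousAt N E) :
    Tendsto (fun L => ∫ ω, countingFunction H₀ ω (Λ L) E ∂P) atTop (𝓝 (N E)) := by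
  have hlim : ∫ _, N E ∂P = N E := by simp
  rw [← hlim]
  refine tendsto_integral_of_dominated_convergence (fun _ => 1) (fun L => ?_)
    (integrable_const _) (fun L => ae_of_all _ fun ω => ?_) ?_
  · simp only [countingFunction_eq_div]
    exact (((measurable_from_top (f := fun n : ℕ => (n : ℝ))).comp
      (measurable_eigenvalueCount H₀ (Λ L) E)).div_const _).aestronglyMeasurable
  · rw [countingFunction_eq_div, Real.norm_of_nonneg (by positivity)]
    exact div_le_one_of_le₀ (by exact_mod_cast eigenvalueCount_le_card H₀ ω (Λ L) E)
      (by positivity)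
  · filter_upwards [hN.tendsto] with ω hω using hω E hE

theorem theorem3p5
    {Γ X : Type*} [Group Γ] [MulAction Γ X]
    (G : SimpleGraph X) (hconn : G.Connected) (hlf : ∀ k, (G.neighborSet k).Finite)
    (haut : ActsByAutomorphisms Γ G)
    (F : Finset X) (hF : ∀ k : X, ∃ γ : Γ, ∃ f ∈ F, k = γ • f)
    (I : ℕ → Finset Γ) (hI : IsTemperedFolner I)
    (H₀ : FiniteHoppingOperator Γ G)
    (P : Measure (Config X)) [IsProbabilityMeasure P]
    (hstat : IsStationaryField Γ P) (herg : IsErgodicFamily Γ P)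
    (hindep : iIndepFun (fun (k : X) (ω : Config X) => ω k) P)
    (hatom : ∀ (k : X) (a : ℝ≥0∞), a ≠ ∞ → P {ω | ω k = a} = 0)
    (N : ℝ → ℝ) (hN : IsIDS H₀ P (exhaustion I F) N) :
    Continuous N := by
  refine continuous_iff_continuousAt.2 fun E => Metric.continuousAt_iff'.2 fun ε hε => ?_
  have hη : 0 < ε / 2 := half_pos hε
  obtain ⟨c, hc0, hct, hc⟩ := hstat.exists_forall_map_eval_Icc_le F hF hatom
    (η := ((ε / 2).toNNReal : ℝ≥0∞)) (by simpa using hη)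
  have hcpos : 0 < c.toReal / 2 := half_pos (ENNReal.toReal_pos hc0 hct)
  have hdense : Dense {x | ContinuousAt N x} := by
    simpa [Set.compl_def] using hN.mono.countable_not_continuousAt.dense_compl ℝ
  -- Keeping within `c / 2` of `E` on either side gives `E₂ < E₁ + c`, as the Wegner estimate needs.
  obtain ⟨E₁, h₁, hE₁, hE₁'⟩ := hdense.exists_between (sub_lt_self E hcpos)
  obtain ⟨E₂, h₂, hE₂, hE₂'⟩ := hdense.exists_between (lt_add_of_pos_right E hcpos)
  have hle : N E₂ ≤ N E₁ + ε / 2 := by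
    refine le_of_tendsto_of_tendsto' (hN.tendsto_integral h₂)
      ((hN.tendsto_integral h₁).add_const _) fun L => ?_
    have := integral_countingFunction_le_add H₀ hindep (exhaustion I F L) hct hc
      (E := E₁) (E' := E₂) (by linarith)
    rwa [Real.coe_toNNReal _ hη.le] at this
  filter_upwards [Ioo_mem_nhds hE₁' hE₂] with x hx
  have h1 := hN.mono hx.1.le
  have h2 := hN.mono hx.2.le
  have h3 := hN.mono hE₁'.le
  have h4 := hN.mono hE₂.le
  rw [Real.dist_eq, abs_lt]
  constructor <;> linarith
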